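/- A domino is a union of two unit squares of the square lattice that share an edge; a domino tiling of $\mathbb{Z}^2$ is a set $t$ of dominoes such that every closed unit square with vertices in $\mathbb{Z}^2$ belongs to exactly one domino of $t$. We use the following notions. (a) $t$ admits a flip if two parallel dominoes of $t$ form a $2\times 2$ square. (b) A doubly-infinite domino staircase is a sequence of dominoes $(s_i)_{i\in\mathbb{Z}}$, all horizontal or all vertical, such that the dominoes neighbouring $s_i$ (i.e. not overlapping it and touching it along an edge) in the sequence are exactly the two dominoes $s_{i-1}$ and $s_{i+1}$; neighbouring dominoes touch along exactly one unit edge, which lies on their longer sides; and $s_{i-1}$, $s_{i+1}$ touch $s_i$ at different squares of $s_i$. (Such a staircase runs along one of the two diagonal directions.) Two such staircases are parallel if they run along the same diagonal direction. $t$ consists entirely of parallel, doubly-infinite domino staircases if $t$ is the union of a family of pairwise parallel doubly-infinite domino staircases. (c) Name a unit square by its lower left corner $(x,y)$. For a square $(a,b)$, the north quadrant with tip $(a,b)$ is the set of squares with $y-b\ge |x-a|$, the south quadrant that with $b-y\ge|x-a|$, the east quadrant that with $x-a\ge|y-b|$, and the west quadrant that with $a-x\ge|y-b|$. North and south quadrants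 can be tiled by vertical dominoes in exactly one way, and east and west quadrants by horizontal dominoes in exactly one way. A windmill tiling is a tiling of $\mathbb{Z}^2$ obtained by choosing a vertex $(p,q)\in\mathbb{Z}^2$, decomposing the plane either into the north, east, south and west quadrants with tips $(p-1,q)$, $(p,q)$, $(p,q-1)$, $(p-1,q-1)$ respectively, or into the north, west, south and east quadrants with tips $(p,q)$, $(p-1,q)$, $(p-1,q-1)$, $(p,q-1)$ respectively, and tiling the north and south quadrants by vertical dominoes and the east and west quadrants by horizontal dominoes. Theorem (Characterization of tilings of the infinite square lattice). Let $t$ be a domino tiling of $\mathbb{Z}^2$. Then exactly one of the following applies: 1. $t$ admits a flip; 2. $t$ consists entirely of parallel, doubly-infinite domino staircases; 3. $t$ is a windmill tiling. -/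

import Mathlib

namespace DominoPlane

/-- A unit square of the infinite square lattice, named by its lower left corner. -/
abbrev Square := ℤ × ℤ

/-- Two unit squares are adjacent when they share an edge. -/
def Adjacent (p q : Square) : Prop :=
  (p.1 = q.1 ∧ (q.2 = p.2 + 1 ∨ p.2 = q.2 + 1)) ∨
    (p.2 = q.2 ∧ (q.1 = p.1 + 1 ∨ p.1 = q.1 + 1))

/-- A domino, given by its lower (if vertical) or left (if horizontal) square and its
orientation. -/
@[ext] structure Domino where
  base : Square
  vertical : Bool

/-- The two unit squares that make up a domino. -/
def Domino.squares (d : Domino) : Set Square :=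
  {d.base, if d.vertical then (d.base.1, d.base.2 + 1) else (d.base.1 + 1, d.base.2)}

/-- A domino tiling of the plane: a collection of dominoes such that every unit square
belongs to exactly one of them. -/
def IsTiling (t : Set Domino) : Prop :=
  ∀ p : Square, ∃! d : Domino, d ∈ t ∧ p ∈ d.squares

/-- The collection `t` admits a flip: two of its dominoes are parallel and form a
2 × 2 square (whose lower left unit square is `p`). -/
def AdmitsFlip (t : Set Domino) : Prop :=
  ∃ p : Square,
    ((⟨p, false⟩ : Domino) ∈ t ∧ (⟨(p.1, p.2 + 1), false⟩ : Domino) ∈ t) ∨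
    ((⟨p, true⟩ : Domino) ∈ t ∧ (⟨(p.1 + 1, p.2), true⟩ : Domino) ∈ t)

/-- The dominoes `d` and `d'` touch along the unit edge between the square `p` of `d` and the
square `q` of `d'`. -/
def TouchAt (d d' : Domino) (p q : Square) : Prop :=
  p ∈ d.squares ∧ q ∈ d'.squares ∧ Adjacent p q

/-- Two dominoes are neighbouring when they do not overlap and touch along an edge. -/
def Neighbouring (d d' : Domino) : Prop :=
  Disjoint d.squares d'.squares ∧ ∃ p q, TouchAt d d' p q

/-- For a square `p` of `d` and an adjacent square `q` outside `d`, the unit edge between `p`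
and `q` lies on one of the two longer sides of `d`. -/
def OnLongSide (d : Domino) (p q : Square) : Prop :=
  if d.vertical then p.2 = q.2 else p.1 = q.1

/-- A doubly-infinite domino staircase, as a sequence of dominoes indexed by `ℤ`. -/
structure IsDoublyInfiniteStaircase (s : ℤ → Domino) : Prop where
  /-- All dominoes are parallel. -/
  parallel : ∀ i j, (s i).vertical = (s j).vertical
  /-- Each domino has exactly two neighbouring dominoes in the staircase, namely its
  predecessor and its successor. -/
  neighbours : ∀ i j, Neighbouring (s i) (s j) ↔ j = i - 1 ∨ j = i + 1
  /-- Neighbouring dominoes touch along exactly one unit edge, and it lies on the longer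
  sides. -/
  touch : ∀ i, ∃ p q, TouchAt (s i) (s (i + 1)) p q ∧ OnLongSide (s i) p q ∧
    ∀ p' q', TouchAt (s i) (s (i + 1)) p' q' → p' = p ∧ q' = q
  /-- The two neighbours of a domino touch it at different squares. -/
  different : ∀ i p q p' q',
    TouchAt (s i) (s (i - 1)) p q → TouchAt (s i) (s (i + 1)) p' q' → p ≠ p'

/-- The displacement between consecutive dominoes of a staircase. -/
def step (s : ℤ → Domino) (i : ℤ) : ℤ × ℤ := (s (i + 1)).base - (s i).base

/-- Two staircases are parallel when they run along the same diagonal direction (possibly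
traversed in opposite senses). -/
def ParallelStaircases (s s' : ℤ → Domino) : Prop :=
  ∀ i j, step s i = step s' j ∨ step s i = -step s' j

/-- `t` consists entirely of parallel, doubly-infinite domino staircases. -/
def ConsistsOfParallelStaircases (t : Set Domino) : Prop :=
  ∃ C : Set (ℤ → Domino),
    (∀ s ∈ C, IsDoublyInfiniteStaircase s) ∧
    (∀ s ∈ C, ∀ s' ∈ C, ParallelStaircases s s') ∧
    t = ⋃ s ∈ C, Set.range s

/-- The vertical dominoes tiling the region `y - p.2 ≥ |x - p.1|`, a quadrant with stair-shaped
border that opens to the north and has `p` as its tip square. -/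
def northQuadrant (p : Square) : Set Domino :=
  {d | d.vertical = true ∧ |d.base.1 - p.1| ≤ d.base.2 - p.2 ∧
    Even (d.base.2 - p.2 - |d.base.1 - p.1|)}

/-- The vertical dominoes tiling the region `p.2 - y ≥ |x - p.1|`; the square of such a domino
nearest to the tip square `p` is its upper one. -/
def southQuadrant (p : Square) : Set Domino :=
  {d | d.vertical = true ∧ |d.base.1 - p.1| ≤ p.2 - (d.base.2 + 1) ∧
    Even (p.2 - (d.base.2 + 1) - |d.base.1 - p.1|)}

/-- The horizontal dominoes tiling the region `x - p.1 ≥ |y - p.2|`. -/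
def eastQuadrant (p : Square) : Set Domino :=
  {d | d.vertical = false ∧ |d.base.2 - p.2| ≤ d.base.1 - p.1 ∧
    Even (d.base.1 - p.1 - |d.base.2 - p.2|)}

/-- The horizontal dominoes tiling the region `p.1 - x ≥ |y - p.2|`; the square of such a domino
nearest to the tip square `p` is its right one. -/
def westQuadrant (p : Square) : Set Domino :=
  {d | d.vertical = false ∧ |d.base.2 - p.2| ≤ p.1 - (d.base.1 + 1) ∧
    Even (p.1 - (d.base.1 + 1) - |d.base.2 - p.2|)}

/-- A windmill tiling: around some vertex `c`, the four unit squares meeting at `c` are the tips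
of the four quadrants, in one of the two possible (mirror-image) arrangements. -/
def IsWindmill (t : Set Domino) : Prop :=
  ∃ c : ℤ × ℤ,
    t = northQuadrant (c.1 - 1, c.2) ∪ eastQuadrant (c.1, c.2) ∪
        southQuadrant (c.1, c.2 - 1) ∪ westQuadrant (c.1 - 1, c.2 - 1) ∨
    t = northQuadrant (c.1, c.2) ∪ westQuadrant (c.1 - 1, c.2) ∪
        southQuadrant (c.1 - 1, c.2 - 1) ∪ eastQuadrant (c.1, c.2 - 1)

end DominoPlane

/-!
Consider a tiling without flips. The unit square above the left square of a horizontal domino `h`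
may lie in a vertical domino `v` standing on `h`. Such a contact propagates: the squares in the
corner between `v` and `h` can then be covered in only one way, so the translates of `h` and `v` by
`(k, k)`, `k ≥ 0`, are present (`FlipFree.ray`). The symmetries of the square lattice give the
corresponding statement for all eight kinds of contact.

If there is no contact at all, every domino has parallel neighbours in all diagonal directions and
the tiling is invariant under diagonal translations. If there is a contact, follow it backwards.
Either it never ends, or at its beginning the dominoes around one vertex form the core of a
windmill (`FlipFree.contact_back_or_core`).

* A contact that never ends yields a diagonal line that no domino crosses. The two diagonals of
  squares next to such a line form one staircase (`FlipFree.strip`), behind which there is another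
  line of this kind. So the plane decomposes into parallel staircases
  (`FlipFree.diagonalInvariant_of_splitsAt`).
* At a core, the contacts between consecutive dominoes send out rays in the four diagonal directions,
  which bound four quadrants. Each of these can then be filled in only one way
  (`FlipFree.north_of_border`).

That the three cases exclude each other rests on the fact that a tiling by parallel staircases is
invariant under a diagonal unit step (`ConsistsOfParallelStaircases.diagonalInvariant`), whereas a
flip or a windmill core overlaps its own translate.
-/

namespace DominoPlane

/-! ### Flip-free domino predicates and their symmetries -/

/-- A flip-free tiling given by two predicates: `H x y` says that the horizontal domino with left
square `(x, y)` is present, `V x y` that the vertical domino with lower square `(x, y)` is. The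
fields say that every square is covered, that no two dominoes overlap, and that no two parallel
dominoes form a 2 × 2 square. In this form each symmetry of the lattice is a substitution in `H`
and `V`. -/
structure FlipFree (H V : ℤ → ℤ → Prop) : Prop where
  cover : ∀ x y, H x y ∨ H (x - 1) y ∨ V x y ∨ V x (y - 1)
  hh : ∀ x y, H x y → ¬ H (x + 1) y
  vv : ∀ x y, V x y → ¬ V x (y + 1)
  hv : ∀ x y, H x y → ¬ V x y ∧ ¬ V (x + 1) y ∧ ¬ V x (y - 1) ∧ ¬ V (x + 1) (y - 1)
  hflip : ∀ x y, H x y → ¬ H x (y + 1)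
  vflip : ∀ x y, V x y → ¬ V (x + 1) y

namespace FlipFree

variable {H V : ℤ → ℤ → Prop}

/-- Reflection in the diagonal `x = y` exchanges the two orientations. -/
theorem transpose (h : FlipFree H V) :
    FlipFree (fun x y => V y x) (fun x y => H y x) where
  cover x y := by have := h.cover y x; tauto
  hh x y := h.vv y x
  vv x y := h.hh y x
  hv x y hx := by
    refine ⟨fun k => (h.hv _ _ k).1 hx, fun k => (h.hv _ _ k).2.2.1 ?_,
      fun k => (h.hv _ _ k).2.1 ?_, fun k => (h.hv _ _ k).2.2.2 ?_⟩ <;> simpa using hx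
  hflip x y := h.vflip y x
  vflip x y := h.hflip y x

/-- The reflection `x ↦ -x` of unit squares; the left square `x` of a horizontal domino goes to the
right square of its image, hence `-x - 1`. -/
theorem reflect (h : FlipFree H V) :
    FlipFree (fun x y => H (-x - 1) y) (fun x y => V (-x) y) where
  cover x y := by
    have := h.cover (-x) y
    grind
  hh x y h1 h2 := h.hh _ _ h2 (by convert h1 using 1; ring)
  vv x y := h.vv _ y
  hv x y hx := by
    have := h.hv _ _ hx
    grind
  hflip x y := h.hflip _ y
  vflip x y h1 h2 := h.vflip _ _ h2 (by convert h1 using 1; ring)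

/-! ### Rays of contacts -/

/-- A vertical domino standing on the left square of a horizontal one forces the same configuration
one step to the north-east: its corner would otherwise be filled by a flip. -/
theorem ray_step (h : FlipFree H V) {x y : ℤ} (h1 : H x y) (h2 : V x (y + 1)) :
    H (x + 1) (y + 1) ∧ V (x + 1) (y + 2) := by
  have a1 := h.hflip x y h1
  have a2 := h.vflip x (y+1) h2
  have a3 := h.hv x y h1
  have a4 := h.cover (x + 1) (y + 1)
  have a5 : H (x + 1) (y + 1) := by
    grind
  refine ⟨a5, ?_⟩
  have a6 := h.hflip _ _ a5
  have a7 := h.hv _ _ a5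
  have a8 := h.cover (x + 1) (y + 2)
  have a9 : ¬ H x (y + 2) := fun k => (h.hv _ _ k).2.2.1 (by convert h2 using 1; ring)
  grind

theorem ray (h : FlipFree H V) {x y : ℤ} (h1 : H x y) (h2 : V x (y + 1)) (k : ℕ) :
    H (x + k) (y + k) ∧ V (x + k) (y + k + 1) := by
  induction k with
  | zero => simpa using ⟨h1, h2⟩
  | succ k ih =>
    have := h.ray_step ih.1 ih.2
    push_cast
    grind

end FlipFree

/-! ### Cores, invariance and splitting diagonals -/

/-- The four unit squares meeting at the vertex `(x, y)` lie in four dominoes that turn around this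
vertex as in the first kind of windmill: vertical to the north and south, horizontal to the east
and west, the north domino standing on the upper left square. -/
def Core (H V : ℤ → ℤ → Prop) (x y : ℤ) : Prop :=
  V (x - 1) y ∧ H x y ∧ V x (y - 2) ∧ H (x - 2) (y - 1)

/-- The mirror image of `Core`, with the north domino standing on the upper right square. -/
def MirrorCore (H V : ℤ → ℤ → Prop) (x y : ℤ) : Prop :=
  V x y ∧ H (x - 2) y ∧ V (x - 1) (y - 2) ∧ H x (y - 1)

/-- Invariance under the translations by `(1, e)` and `(-1, -e)`; used for `e = 1` and `e = -1`. -/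
def DiagonalInvariant (H V : ℤ → ℤ → Prop) (e : ℤ) : Prop :=
  ∀ x y, (H x y → H (x + 1) (y + e) ∧ H (x - 1) (y - e)) ∧
    (V x y → V (x + 1) (y + e) ∧ V (x - 1) (y - e))

/-- No domino crosses the staircase line that separates the squares with `x - y = c - 1` from those
with `x - y = c`. -/
def SplitsAt (H V : ℤ → ℤ → Prop) (c : ℤ) : Prop :=
  ∀ y, ¬ H (y + c - 1) y ∧ ¬ V (y + c) y

namespace FlipFree
variable {H V : ℤ → ℤ → Prop}

/-- A contact of a horizontal domino with a vertical one on its left square either continues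
one step to the south-west or starts at a core, according to the domino that covers the square to
the left of the horizontal one. -/
theorem contact_back_or_core (h : FlipFree H V) {x y : ℤ} (h1 : H x y) (h2 : V x (y + 1)) :
    (H (x - 1) (y - 1) ∧ V (x - 1) y) ∨ Core H V x y ∨ MirrorCore H V x (y + 1) := by
  rcases h.cover (x - 1) y with a | a | a | a
  · exact absurd (by simpa using h1) (h.hh _ _ a)
  · -- The square `(x - 1, y + 1)` cannot be covered.
    exfalso
    have b1 := h.hflip _ _ a
    have b2 : ¬ V (x - 1) (y + 1) := fun k => h.vflip _ _ k (by simpa using h2)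
    have b3 := h.hv _ _ a
    have b4 : ¬ H (x - 1) (y + 1) := fun k => (h.hv _ _ k).2.1 (by simpa using h2)
    have := h.cover (x - 1) (y + 1)
    grind
  · by_cases b : H (x - 1) (y - 1)
    · exact .inl ⟨b, a⟩
    · right; left
      have c1 : V x (y - 2) := by
        have := h.cover x (y - 1)
        have c2 : ¬ H x (y - 1) := fun k => h.hflip _ _ k (by simpa using h1)
        have c3 := h.hv _ _ h1
        grind
      have c4 : H (x - 2) (y - 1) := by
        have := h.cover (x - 1) (y - 1)
        have c5 : ¬ V (x - 1) (y - 2) := fun k => h.vflip _ _ k (by simpa using c1)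
        have c6 : ¬ V (x - 1) (y - 1) := fun k => h.vv _ _ k (by simpa using a)
        grind
      exact ⟨a, h1, c1, c4⟩
  · right; right
    have b2 : ¬ V (x - 1) (y + 1) := fun k => h.vflip _ _ k (by simpa using h2)
    have b4 : ¬ H (x - 1) (y + 1) := fun k => (h.hv _ _ k).2.1 (by simpa using h2)
    have b5 : ¬ V (x - 1) y := by simpa using h.vv _ _ a
    have := h.cover (x - 1) (y + 1)
    have : H (x - 2) (y + 1) := by grind
    refine ⟨h2, this, ?_, ?_⟩
    · convert a using 1; ring
    · simpa using h1

/-- If no domino crosses a diagonal line, then the strip of squares with `x - y ∈ {c, c + 1}` on one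
side of it is a single doubly-infinite staircase. If a horizontal domino on this strip were followed
to the south-west by a vertical one, then the square `(y + c, y - 1)` between them would force a
flip or an overlap. -/
theorem strip (h : FlipFree H V) {c : ℤ} (hc : SplitsAt H V c) :
    (∀ y, H (y + c) y) ∨ (∀ y, V (y + c) (y - 1)) := by
  have key : ∀ y, H (y + c) y ∨ V (y + c) (y - 1) := fun y => by
    have := h.cover (y + c) y
    have := hc y
    tauto
  have up : ∀ y, H (y + c) y → H (y + 1 + c) (y + 1) := fun y hy => by
    refine (key (y + 1)).resolve_right fun k => (h.hv _ _ hy).2.1 ?_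
    convert k using 1 <;> ring
  have down : ∀ y, H (y + c) y → H (y - 1 + c) (y - 1) := fun y hy => by
    refine (key (y - 1)).resolve_right fun k => ?_
    have b1 := h.hv _ _ hy
    have b2 : ¬ H (y + c) (y - 1) := fun k => h.hflip _ _ k (by simpa using hy)
    have b3 := h.vflip _ _ k
    have b4 : ¬ H (y + c - 1) (y - 1) := fun k' => (h.hv _ _ k').2.2.1 (by convert k using 1; ring)
    have := h.cover (y + c) (y - 1)
    grind
  by_cases h0 : H (0 + c) 0
  · left
    intro y
    induction y using Int.induction_on with
    | zero => exact h0
    | succ i ih => exact up _ ih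
    | pred i ih => exact down _ ih
  · right
    have : ∀ y, ¬ H (y + c) y := fun y => by
      induction y using Int.induction_on with
      | zero => exact h0
      | succ i ih => exact fun k => ih (by simpa using down _ k)
      | pred i ih => exact fun k => ih (by simpa using up _ k)
    exact fun y => (key y).resolve_left (this y)

theorem splitsAt_add_two (h : FlipFree H V) {c : ℤ} (hc : SplitsAt H V c) :
    SplitsAt H V (c + 2) := by
  intro y
  rcases h.strip hc with k | k
  · have k1 := h.hh _ _ (k y)
    have k2 := h.hv _ _ (k (y + 1))
    grind
  · constructor
    · intro k'
      have k2 := h.hv _ _ k'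
      have := k (y + 1)
      grind
    · have k1 := h.vv _ _ (k (y + 2))
      have k3 := k (y + 2)
      have k2 := h.vv (y + 2 + c) y
      grind

theorem rotate_half (h : FlipFree H V) :
    FlipFree (fun x y => H (-x - 1) (-y)) (fun x y => V (-x) (-y - 1)) :=
  h.reflect.transpose.reflect.transpose

/-- The half-turn exchanges the two sides of the line. -/
theorem splitsAt_sub_two (h : FlipFree H V) {c : ℤ} (hc : SplitsAt H V c) :
    SplitsAt H V (c - 2) := by
  -- The half-turn maps the diagonals `c - 1 | c` to `-c | 1 - c`.
  have h' : SplitsAt (fun x y => H (-x - 1) (-y)) (fun x y => V (-x) (-y - 1)) (1 - c) := fun y => by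
    have h1 := (hc (-y)).1
    have h2 := (hc (-y - 1)).2
    grind
  intro y
  have h1 := (h.rotate_half.splitsAt_add_two h' (-y)).1
  have h2 := (h.rotate_half.splitsAt_add_two h' (-y - 1)).2
  grind

theorem splitsAt_add_two_mul (h : FlipFree H V) {c : ℤ} (hc : SplitsAt H V c) (j : ℤ) :
    SplitsAt H V (c + 2 * j) := by
  induction j using Int.induction_on with
  | zero => simpa using hc
  | succ i ih => have := h.splitsAt_add_two ih; grind
  | pred i ih => have := h.splitsAt_sub_two ih; grind

theorem diagonalInvariant_of_splitsAt (h : FlipFree H V) {c : ℤ} (hc : SplitsAt H V c) :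
    DiagonalInvariant H V 1 := by
  have all := h.splitsAt_add_two_mul hc
  intro x y
  constructor
  · intro hx
    obtain ⟨j, hj⟩ : ∃ j, x = y + (c + 2 * j) := by
      rcases Int.even_or_odd' (x - y - c) with ⟨j, hj | hj⟩
      · exact ⟨j, by omega⟩
      · exact absurd (by convert hx using 1; linarith) (all (j + 1) y).1
    have : ∀ y, H (y + (c + 2 * j)) y := (h.strip (all j)).resolve_right fun k => by
      have := (h.hv _ _ hx)
      have := k y
      grind
    have h1 := this (y + 1)
    have h2 := this (y - 1)
    grind
  · intro hx
    obtain ⟨j, hj⟩ : ∃ j, x = y + 1 + (c + 2 * j) := by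
      rcases Int.even_or_odd' (x - y - 1 - c) with ⟨j, hj | hj⟩
      · exact ⟨j, by omega⟩
      · exact absurd (by convert hx using 1; linarith) (all (j + 1) y).2
    have : ∀ y, V (y + (c + 2 * j)) (y - 1) := (h.strip (all j)).resolve_left fun k => by
      have := h.hv _ _ (k (y + 1))
      grind
    have h1 := this (y + 2)
    have h2 := this y
    grind

/-- A flip-free pattern is invariant under one of the two diagonal directions or contains a core. -/
def InvariantOrCore (H V : ℤ → ℤ → Prop) : Prop :=
  DiagonalInvariant H V 1 ∨ DiagonalInvariant H V (-1) ∨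
    (∃ x y, Core H V x y) ∨ ∃ x y, MirrorCore H V x y

/-- Without a core, a contact continues in both directions along its diagonal, and no domino crosses
the line between its two staircases. -/
theorem invariantOrCore_of_contact (h : FlipFree H V) {x y : ℤ} (h1 : H x y) (h2 : V x (y + 1)) :
    InvariantOrCore H V := by
  by_cases hcore : (∃ x y, Core H V x y) ∨ ∃ x y, MirrorCore H V x y
  · exact .inr (.inr hcore)
  have back : ∀ k : ℕ, H (x - k) (y - k) ∧ V (x - k) (y - k + 1) := fun k => by
    induction k with
    | zero => simpa using ⟨h1, h2⟩
    | succ k ih =>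
      rcases h.contact_back_or_core ih.1 ih.2 with a | a | a
      · push_cast; grind
      · exact absurd (.inl ⟨_, _, a⟩) hcore
      · exact absurd (.inr ⟨_, _, a⟩) hcore
  have all : ∀ z, H (z + (x - y)) z := fun z => by
    rcases le_total y z with hz | hz
    · obtain ⟨k, hk⟩ := Int.eq_ofNat_of_zero_le (sub_nonneg.2 hz)
      have := (h.ray h1 h2 k).1
      rw [← hk] at this
      grind
    · obtain ⟨k, hk⟩ := Int.eq_ofNat_of_zero_le (sub_nonneg.2 hz)
      have := (back k).1
      rw [← hk] at this
      grind
  refine .inl (h.diagonalInvariant_of_splitsAt (c := x - y) fun z => ⟨fun k => ?_, ?_⟩)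
  · exact h.hh _ _ k (by simpa using all z)
  · exact (h.hv _ _ (all z)).1

theorem InvariantOrCore.of_transpose (o : InvariantOrCore (fun x y => V y x) (fun x y => H y x)) :
    InvariantOrCore H V := by
  rcases o with o | o | ⟨x, y, o⟩ | ⟨x, y, o⟩
  · refine .inl fun x y => ?_
    have := o y x
    tauto
  · refine .inr (.inl fun x y => ?_)
    have h1 := o y x
    simp only [← sub_eq_add_neg, sub_neg_eq_add] at h1 ⊢
    tauto
  · refine .inr (.inr (.inr ⟨y, x, ?_⟩))
    unfold Core at o; unfold MirrorCore; tauto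
  · refine .inr (.inr (.inl ⟨y, x, ?_⟩))
    unfold MirrorCore at o; unfold Core; tauto

theorem InvariantOrCore.of_reflect (o : InvariantOrCore (fun x y => H (-x - 1) y) (fun x y => V (-x) y)) :
    InvariantOrCore H V := by
  rcases o with o | o | ⟨x, y, o⟩ | ⟨x, y, o⟩
  · refine .inr (.inl fun x y => ?_)
    have h1 := (o (-x - 1) y).1
    have h2 := (o (-x) y).2
    grind
  · refine .inl fun x y => ?_
    have h1 := (o (-x - 1) y).1
    have h2 := (o (-x) y).2
    grind
  · refine .inr (.inr (.inr ⟨-x + 1, y, ?_⟩))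
    unfold Core at o; unfold MirrorCore; grind
  · refine .inr (.inr (.inl ⟨-x + 1, y, ?_⟩))
    unfold MirrorCore at o; unfold Core; grind

theorem not_contact_of_not_invariantOrCore (h : FlipFree H V) (ho : ¬ InvariantOrCore H V) (x y : ℤ) :
    H x y → ¬ V x (y + 1) ∧ ¬ V (x + 1) (y + 1) := fun hx => by
  refine ⟨fun k => ho (h.invariantOrCore_of_contact hx k), fun k => ho (InvariantOrCore.of_reflect ?_)⟩
  refine h.reflect.invariantOrCore_of_contact (x := -x - 1) (y := y) ?_ ?_
  · simpa using hx
  · convert k using 1; ring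

theorem no_contact_below (h : FlipFree H V) (ho : ¬ InvariantOrCore H V) (x y : ℤ) :
    H x y → ¬ V x (y - 2) ∧ ¬ V (x + 1) (y - 2) := fun hx => by
  have := h.rotate_half.not_contact_of_not_invariantOrCore
    (fun o => ho (.of_reflect (.of_transpose (.of_reflect (.of_transpose o))))) (-x - 1) (-y)
  grind

theorem horizontal_invariant (h : FlipFree H V) (ho : ¬ InvariantOrCore H V) (x y : ℤ) (hx : H x y) :
    H (x + 1) (y + 1) ∧ H (x - 1) (y - 1) := by
  have a1 := h.not_contact_of_not_invariantOrCore ho x y hx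
  have a2 := h.no_contact_below ho x y hx
  have a3 := h.hv _ _ hx
  have a4 := h.hflip _ _ hx
  have a5 : ¬ H x (y - 1) := fun k => h.hflip _ _ k (by simpa using hx)
  have a6 := h.cover (x + 1) (y + 1)
  have a7 := h.cover x (y - 1)
  grind

/-- Without any contact of a short side with a long side, each domino has parallel neighbours in all
four diagonal directions. -/
theorem invariantOrCore (h : FlipFree H V) : InvariantOrCore H V := by
  by_contra ho
  refine ho (.inl fun x y => ⟨h.horizontal_invariant ho x y, fun hx => ?_⟩)
  exact (h.transpose.horizontal_invariant (fun o => ho o.of_transpose) y x hx)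


/-! ### The quadrants around a core -/

theorem rotate_quarter (h : FlipFree H V) :
    FlipFree (fun x y => V (-y) x) (fun x y => H (-y - 1) x) :=
  h.reflect.transpose

/-- Two rays of vertical dominoes leaving `(p, q)` to the north-east and the north-west determine the
tiling of the quadrant between them, by induction on the height: the square above the tiled part
has both neighbours and the square below covered. -/
theorem north_of_border (h : FlipFree H V) {p q : ℤ}
    (hr : ∀ k : ℕ, V (p + k) (q + k)) (hl : ∀ k : ℕ, V (p - k) (q + k)) (n : ℕ) :
    ∀ a b : ℤ, b - q ≤ n → |a - p| ≤ b - q → Even (b - q - |a - p|) → V a b := by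
  induction n with
  | zero =>
    intro a b hn h1 _
    have h0 := abs_nonneg (a - p)
    have : |a - p| = 0 := by push_cast at hn; omega
    have hp : a = p := by rw [abs_eq_zero] at this; omega
    have hq : b = q := by push_cast at hn; omega
    simpa [hp, hq] using hr 0
  | succ n ih =>
    intro a b hn h1 h2
    push_cast at hn
    rcases h1.eq_or_lt with h3 | h3
    · rcases abs_cases (a - p) with ⟨e, e'⟩ | ⟨e, e'⟩
      · have := hr (a - p).toNat
        grind
      · have := hl (p - a).toNat
        grind
    · rw [Int.even_iff] at h2
      have below : V a (b - 2) := ih a (b - 2) (by omega) (by omega) (by rw [Int.even_iff]; omega)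
      have left : V (a - 1) (b - 1) := by
        refine ih _ _ (by omega) ?_ ?_ <;> rw [abs] at * <;> [skip; rw [Int.even_iff]] <;> omega
      have right : V (a + 1) (b - 1) := by
        refine ih _ _ (by omega) ?_ ?_ <;> rw [abs] at * <;> [skip; rw [Int.even_iff]] <;> omega
      have h4 := h.cover a b
      have h5 : ¬ H a b := fun k => (h.hv _ _ k).2.2.2 right
      have h6 : ¬ H (a - 1) b := fun k => (h.hv _ _ k).2.2.1 left
      have h7 := h.vv _ _ below
      grind

/-- The contacts of the north domino of a core with its east and west dominoes produce the two rays
that bound the north quadrant. The other quadrants follow by quarter turns. -/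
theorem north_of_core (h : FlipFree H V) {x y : ℤ} (hc : Core H V x y) (a b : ℤ)
    (h1 : |a - (x - 1)| ≤ b - y) (h2 : Even (b - y - |a - (x - 1)|)) : V a b := by
  obtain ⟨v, e, _, w⟩ := hc
  refine h.north_of_border (p := x - 1) (q := y) (fun k => ?_) (fun k => ?_) (b - y).toNat a b
    (by omega) h1 h2
  · have := (h.transpose.ray (x := y) (y := x - 1) v (by simpa using e) k).1
    exact this
  · have := (h.reflect.ray (x := 1 - x) (y := y - 1) (by convert w using 1; ring)
      (by convert v using 1 <;> ring) k).2
    grind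

theorem west_of_core (h : FlipFree H V) {x y : ℤ} (hc : Core H V x y) (a b : ℤ)
    (h1 : |b - (y - 1)| ≤ x - 1 - (a + 1)) (h2 : Even (x - 1 - (a + 1) - |b - (y - 1)|)) :
    H a b := by
  have hc' : Core (fun x y => V (-y) x) (fun x y => H (-y - 1) x) y (1 - x) := by
    unfold Core at *; grind
  have := h.rotate_quarter.north_of_core hc' b (-a - 1) (by grind) (by grind)
  grind

theorem south_of_core (h : FlipFree H V) {x y : ℤ} (hc : Core H V x y) (a b : ℤ)
    (h1 : |a - x| ≤ y - 1 - (b + 1)) (h2 : Even (y - 1 - (b + 1) - |a - x|)) :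
    V a b := by
  have hc' : Core (fun x y => V (-y) x) (fun x y => H (-y - 1) x) y (1 - x) := by
    unfold Core at *; grind
  have e : |-a - (1 - x - 1)| = |a - x| := by rw [← abs_neg]; congr 1; ring
  have := h.rotate_quarter.west_of_core hc' b (-a) (by rw [e]; omega) (by rw [e]; exact h2)
  simpa using this

theorem east_of_core (h : FlipFree H V) {x y : ℤ} (hc : Core H V x y) (a b : ℤ)
    (h1 : |b - y| ≤ a - x) (h2 : Even (a - x - |b - y|)) : H a b := by
  have hc' : Core (fun x y => V (-y) x) (fun x y => H (-y - 1) x) y (1 - x) := by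
    unfold Core at *; grind
  have := h.rotate_quarter.south_of_core hc' b (-a - 1) (by grind) (by grind)
  grind

end FlipFree

/-! ### From tilings to domino predicates -/

theorem mem_squares {x y a b : ℤ} {o : Bool} : (a, b) ∈ (⟨(x, y), o⟩ : Domino).squares ↔
    (a = x ∧ b = y) ∨ (o = true ∧ a = x ∧ b = y + 1) ∨ (o = false ∧ a = x + 1 ∧ b = y) := by
  cases o <;> simp [Domino.squares, Prod.ext_iff]

theorem IsTiling.eq_of_overlap {t : Set Domino} (ht : IsTiling t) {d d' : Domino} (hd : d ∈ t)
    (hd' : d' ∈ t) {p : Square} (hp : p ∈ d.squares) (hp' : p ∈ d'.squares) : d = d' :=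
  (ht p).unique ⟨hd, hp⟩ ⟨hd', hp'⟩

/-- A tiling has no proper subset that covers the plane. -/
theorem IsTiling.eq_of_subset {t W : Set Domino} (ht : IsTiling t) (hW : W ⊆ t)
    (hcov : ∀ p : Square, ∃ d ∈ W, p ∈ d.squares) : t = W := by
  refine Set.Subset.antisymm (fun d hd => ?_) hW
  obtain ⟨d', hd', hp⟩ := hcov d.base
  rwa [ht.eq_of_overlap hd (hW hd') (p := d.base) (by simp [Domino.squares]) hp]

/-- The horizontal domino with left square `(x, y)` belongs to `t`. -/
def HorizontalAt (t : Set Domino) (x y : ℤ) : Prop := (⟨(x, y), false⟩ : Domino) ∈ t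

/-- The vertical domino with lower square `(x, y)` belongs to `t`. -/
def VerticalAt (t : Set Domino) (x y : ℤ) : Prop := (⟨(x, y), true⟩ : Domino) ∈ t

theorem IsTiling.flipFree {t : Set Domino} (ht : IsTiling t) (hf : ¬ AdmitsFlip t) :
    FlipFree (HorizontalAt t) (VerticalAt t) where
  cover x y := by
    obtain ⟨⟨⟨a, b⟩, o⟩, ⟨hd, hp⟩, -⟩ := ht (x, y)
    rw [mem_squares] at hp
    unfold HorizontalAt VerticalAt
    cases o <;> grind
  hh x y h1 h2 := by
    have := ht.eq_of_overlap (p := (x + 1, y)) h1 h2 (by simp [mem_squares]) (by simp [mem_squares])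
    simp at this
  vv x y h1 h2 := by
    have := ht.eq_of_overlap (p := (x, y + 1)) h1 h2 (by simp [mem_squares]) (by simp [mem_squares])
    simp at this
  hv x y h1 := by
    refine ⟨fun h2 => ?_, fun h2 => ?_, fun h2 => ?_, fun h2 => ?_⟩
    · have := ht.eq_of_overlap (p := (x, y)) h1 h2 (by simp [mem_squares]) (by simp [mem_squares])
      simp at this
    · have := ht.eq_of_overlap (p := (x + 1, y)) h1 h2 (by simp [mem_squares])
        (by simp [mem_squares])
      simp at this
    · have := ht.eq_of_overlap (p := (x, y)) h1 h2 (by simp [mem_squares]) (by simp [mem_squares])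
      simp at this
    · have := ht.eq_of_overlap (p := (x + 1, y)) h1 h2 (by simp [mem_squares])
        (by simp [mem_squares])
      simp at this
  hflip x y h1 h2 := hf ⟨(x, y), .inl ⟨h1, h2⟩⟩
  vflip x y h1 h2 := hf ⟨(x, y), .inr ⟨h1, h2⟩⟩


/-! ### Windmills -/

theorem exists_mem_northQuadrant {p q a b : ℤ} (h : |a - p| ≤ b - q) :
    ∃ d ∈ northQuadrant (p, q), (a, b) ∈ d.squares := by
  rcases Int.even_or_odd (b - q - |a - p|) with k | k
  · exact ⟨⟨(a, b), true⟩, ⟨rfl, h, k⟩, by simp [mem_squares]⟩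
  · rw [Int.odd_iff] at k
    exact ⟨⟨(a, b - 1), true⟩, ⟨rfl, by dsimp only; omega, by rw [Int.even_iff]; dsimp only; omega⟩,
      by simp [mem_squares]⟩

theorem exists_mem_southQuadrant {p q a b : ℤ} (h : |a - p| ≤ q - b) :
    ∃ d ∈ southQuadrant (p, q), (a, b) ∈ d.squares := by
  rcases Int.even_or_odd (q - b - |a - p|) with k | k
  · exact ⟨⟨(a, b - 1), true⟩, ⟨rfl, by simpa using h, by simpa using k⟩, by simp [mem_squares]⟩
  · rw [Int.odd_iff] at k
    exact ⟨⟨(a, b), true⟩, ⟨rfl, by dsimp only; omega, by rw [Int.even_iff]; dsimp only; omega⟩,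
      by simp [mem_squares]⟩

theorem exists_mem_eastQuadrant {p q a b : ℤ} (h : |b - q| ≤ a - p) :
    ∃ d ∈ eastQuadrant (p, q), (a, b) ∈ d.squares := by
  rcases Int.even_or_odd (a - p - |b - q|) with k | k
  · exact ⟨⟨(a, b), false⟩, ⟨rfl, h, k⟩, by simp [mem_squares]⟩
  · rw [Int.odd_iff] at k
    exact ⟨⟨(a - 1, b), false⟩, ⟨rfl, by dsimp only; omega, by rw [Int.even_iff]; dsimp only; omega⟩,
      by simp [mem_squares]⟩

theorem exists_mem_westQuadrant {p q a b : ℤ} (h : |b - q| ≤ p - a) :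
    ∃ d ∈ westQuadrant (p, q), (a, b) ∈ d.squares := by
  rcases Int.even_or_odd (p - a - |b - q|) with k | k
  · exact ⟨⟨(a - 1, b), false⟩, ⟨rfl, by simpa using h, by simpa using k⟩, by simp [mem_squares]⟩
  · rw [Int.odd_iff] at k
    exact ⟨⟨(a, b), false⟩, ⟨rfl, by dsimp only; omega, by rw [Int.even_iff]; dsimp only; omega⟩,
      by simp [mem_squares]⟩

theorem IsTiling.isWindmill_of_core {t : Set Domino} (ht : IsTiling t) (hf : ¬ AdmitsFlip t)
    {x y : ℤ} (hc : Core (HorizontalAt t) (VerticalAt t) x y) : IsWindmill t := by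
  have h := ht.flipFree hf
  refine ⟨(x, y), .inl (ht.eq_of_subset ?_ ?_)⟩
  · rintro ⟨⟨a, b⟩, o⟩ (((⟨rfl, h1, h2⟩ | ⟨rfl, h1, h2⟩) | ⟨rfl, h1, h2⟩) | ⟨rfl, h1, h2⟩)
    · exact h.north_of_core hc a b h1 h2
    · exact h.east_of_core hc a b h1 h2
    · exact h.south_of_core hc a b h1 h2
    · exact h.west_of_core hc a b h1 h2
  · rintro ⟨a, b⟩
    have : |a - (x - 1)| ≤ b - y ∨ |b - y| ≤ a - x ∨ |a - x| ≤ y - 1 - b ∨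
        |b - (y - 1)| ≤ x - 1 - a := by
      simp only [abs_le]
      omega
    rcases this with k | k | k | k
    · exact (exists_mem_northQuadrant k).imp fun d hd => ⟨.inl (.inl (.inl hd.1)), hd.2⟩
    · exact (exists_mem_eastQuadrant k).imp fun d hd => ⟨.inl (.inl (.inr hd.1)), hd.2⟩
    · exact (exists_mem_southQuadrant k).imp fun d hd => ⟨.inl (.inr hd.1), hd.2⟩
    · exact (exists_mem_westQuadrant k).imp fun d hd => ⟨.inr hd.1, hd.2⟩

theorem IsTiling.isWindmill_of_mirrorCore {t : Set Domino} (ht : IsTiling t)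
    (hf : ¬ AdmitsFlip t) {x y : ℤ} (hc : MirrorCore (HorizontalAt t) (VerticalAt t) x y) :
    IsWindmill t := by
  have h := (ht.flipFree hf).reflect
  have hc' : Core (fun x y => HorizontalAt t (-x - 1) y) (fun x y => VerticalAt t (-x) y)
      (1 - x) y := by
    unfold Core; unfold MirrorCore at hc; grind
  refine ⟨(x, y), .inr (ht.eq_of_subset ?_ ?_)⟩
  · rintro ⟨⟨a, b⟩, o⟩ (((⟨rfl, h1, h2⟩ | ⟨rfl, h1, h2⟩) | ⟨rfl, h1, h2⟩) | ⟨rfl, h1, h2⟩) <;>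
      dsimp only at h1 h2
    · have e : |-a - (1 - x - 1)| = |a - x| := by rw [← abs_neg]; congr 1; ring
      simpa [VerticalAt] using h.north_of_core hc' (-a) b (by rwa [e]) (by rwa [e])
    · have := h.east_of_core hc' (-a - 1) b (by omega) (by grind)
      simpa [HorizontalAt] using this
    · have e : |-a - (1 - x)| = |a - (x - 1)| := by rw [← abs_neg]; congr 1; ring
      simpa [VerticalAt] using h.south_of_core hc' (-a) b (by rwa [e]) (by rwa [e])
    · have := h.west_of_core hc' (-a - 1) b (by omega) (by grind)
      simpa [HorizontalAt] using this
  · rintro ⟨a, b⟩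
    have : |a - x| ≤ b - y ∨ |b - y| ≤ x - 1 - a ∨ |a - (x - 1)| ≤ y - 1 - b ∨
        |b - (y - 1)| ≤ a - x := by
      simp only [abs_le]
      omega
    rcases this with k | k | k | k
    · exact (exists_mem_northQuadrant k).imp fun d hd => ⟨.inl (.inl (.inl hd.1)), hd.2⟩
    · exact (exists_mem_westQuadrant k).imp fun d hd => ⟨.inl (.inl (.inr hd.1)), hd.2⟩
    · exact (exists_mem_southQuadrant k).imp fun d hd => ⟨.inl (.inr hd.1), hd.2⟩
    · exact (exists_mem_eastQuadrant k).imp fun d hd => ⟨.inr hd.1, hd.2⟩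

/-! ### Staircases -/

theorem neighbouring_horizontal {x y x' y' : ℤ} :
    Neighbouring ⟨(x, y), false⟩ ⟨(x', y'), false⟩ ↔
      ((y' = y + 1 ∨ y' = y - 1) ∧ x - 1 ≤ x' ∧ x' ≤ x + 1) ∨
        (y' = y ∧ (x' = x + 2 ∨ x' = x - 2)) := by
  constructor
  · rintro ⟨hd, ⟨a, b⟩, ⟨c, d⟩, hp, hq, hadj⟩
    rw [Set.disjoint_left] at hd
    have d1 := @hd (x, y)
    have d2 := @hd (x + 1, y)
    simp only [mem_squares, Adjacent] at *
    simp at d1 d2 hp hq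
    omega
  · intro h
    refine ⟨Set.disjoint_left.2 ?_, ?_⟩
    · rintro ⟨a, b⟩ h1 h2
      simp [mem_squares] at h1 h2
      omega
    · have : ∃ a b c d : ℤ, TouchAt ⟨(x, y), false⟩ ⟨(x', y'), false⟩ (a, b) (c, d) := by
        simp only [TouchAt, mem_squares, Adjacent]
        rcases h with ⟨h, h1, h2⟩ | ⟨h, h1 | h1⟩
        · rcases h1.eq_or_lt with h3 | h3
          · exact ⟨x, y, x, y', by simp; omega⟩
          · exact ⟨x', y, x', y', by simp; omega⟩
        · exact ⟨x + 1, y, x', y', by simp; omega⟩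
        · exact ⟨x, y, x' + 1, y', by simp; omega⟩
      obtain ⟨a, b, c, d, h⟩ := this
      exact ⟨_, _, h⟩

theorem neighbouring_vertical {x y x' y' : ℤ} :
    Neighbouring ⟨(x, y), true⟩ ⟨(x', y'), true⟩ ↔
      ((x' = x + 1 ∨ x' = x - 1) ∧ y - 1 ≤ y' ∧ y' ≤ y + 1) ∨
        (x' = x ∧ (y' = y + 2 ∨ y' = y - 2)) := by
  constructor
  · rintro ⟨hd, ⟨a, b⟩, ⟨c, d⟩, hp, hq, hadj⟩
    rw [Set.disjoint_left] at hd
    have d1 := @hd (x, y)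
    have d2 := @hd (x, y + 1)
    simp only [mem_squares, Adjacent] at *
    simp at d1 d2 hp hq
    omega
  · intro h
    refine ⟨Set.disjoint_left.2 ?_, ?_⟩
    · rintro ⟨a, b⟩ h1 h2
      simp [mem_squares] at h1 h2
      omega
    · have : ∃ a b c d : ℤ, TouchAt ⟨(x, y), true⟩ ⟨(x', y'), true⟩ (a, b) (c, d) := by
        simp only [TouchAt, mem_squares, Adjacent]
        rcases h with ⟨h, h1, h2⟩ | ⟨h, h1 | h1⟩
        · rcases h1.eq_or_lt with h3 | h3
          · exact ⟨x, y, x', y, by simp; omega⟩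
          · exact ⟨x, y', x', y', by simp; omega⟩
        · exact ⟨x, y + 1, x', y', by simp; omega⟩
        · exact ⟨x, y, x', y' + 1, by simp; omega⟩
      obtain ⟨a, b, c, d, h⟩ := this
      exact ⟨_, _, h⟩

/-- The translates of `d` by the multiples of `(1, e)`. -/
def diagonalStaircase (d : Domino) (e : ℤ) (i : ℤ) : Domino :=
  ⟨(d.base.1 + i, d.base.2 + e * i), d.vertical⟩

theorem isDoublyInfiniteStaircase_diagonalStaircase (d : Domino) {e : ℤ} (he : e = 1 ∨ e = -1) :
    IsDoublyInfiniteStaircase (diagonalStaircase d e) := by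
  obtain ⟨⟨x, y⟩, o⟩ := d
  refine ⟨fun i j => rfl, fun i j => ?_, fun i => ?_, ?_⟩
  · cases o <;> simp only [diagonalStaircase, neighbouring_horizontal, neighbouring_vertical] <;>
      rcases he with rfl | rfl <;> omega
  · cases o
    · refine ⟨(x + i + 1, y + e * i), (x + i + 1, y + e * (i + 1)), ?_, ?_, ?_⟩
      · simp only [diagonalStaircase, TouchAt, mem_squares, Adjacent]
        rcases he with rfl | rfl <;> simp <;> omega
      · simp [OnLongSide, diagonalStaircase]
      · rintro ⟨a, b⟩ ⟨a', b'⟩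
        simp only [diagonalStaircase, TouchAt, mem_squares, Adjacent, Prod.mk.injEq]
        rcases he with rfl | rfl <;> simp <;> omega
    · rcases he with rfl | rfl
      · refine ⟨(x + i, y + i + 1), (x + i + 1, y + i + 1), ?_, ?_, ?_⟩
        · simp only [diagonalStaircase, TouchAt, mem_squares, Adjacent]
          simp; omega
        · simp [OnLongSide, diagonalStaircase]
        · rintro ⟨a, b⟩ ⟨a', b'⟩
          simp only [diagonalStaircase, TouchAt, mem_squares, Adjacent, Prod.mk.injEq]
          simp; omega
      · refine ⟨(x + i, y - i), (x + i + 1, y - i), ?_, ?_, ?_⟩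
        · simp only [diagonalStaircase, TouchAt, mem_squares, Adjacent]
          simp; omega
        · simp [OnLongSide, diagonalStaircase]
        · rintro ⟨a, b⟩ ⟨a', b'⟩
          simp only [diagonalStaircase, TouchAt, mem_squares, Adjacent, Prod.mk.injEq]
          simp; omega
  · rintro i ⟨a, b⟩ ⟨a', b'⟩ ⟨c, f⟩ ⟨c', f'⟩
    simp only [diagonalStaircase, TouchAt, mem_squares, Adjacent, ne_eq, Prod.mk.injEq]
    cases o <;> rcases he with rfl | rfl <;> simp <;> omega

theorem consistsOfParallelStaircases_of_diagonalInvariant {t : Set Domino} {e : ℤ}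
    (he : e = 1 ∨ e = -1) (hi : DiagonalInvariant (HorizontalAt t) (VerticalAt t) e) :
    ConsistsOfParallelStaircases t := by
  have one : ∀ d ∈ t, ∀ i, diagonalStaircase d e i ∈ t := by
    rintro ⟨⟨x, y⟩, o⟩ hd i
    induction i using Int.induction_on with
    | zero => simpa [diagonalStaircase] using hd
    | succ i ih =>
      cases o
      · have := ((hi _ _).1 ih).1
        simp only [HorizontalAt, diagonalStaircase] at this ⊢
        convert this using 3 <;> ring
      · have := ((hi _ _).2 ih).1
        simp only [VerticalAt, diagonalStaircase] at this ⊢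
        convert this using 3 <;> ring
    | pred i ih =>
      cases o
      · have := ((hi _ _).1 ih).2
        simp only [HorizontalAt, diagonalStaircase] at this ⊢
        convert this using 3 <;> ring
      · have := ((hi _ _).2 ih).2
        simp only [VerticalAt, diagonalStaircase] at this ⊢
        convert this using 3 <;> ring
  refine ⟨(diagonalStaircase · e) '' t, ?_, ?_, ?_⟩
  · rintro _ ⟨d, -, rfl⟩
    exact isDoublyInfiniteStaircase_diagonalStaircase d he
  · rintro _ ⟨d, -, rfl⟩ _ ⟨d', -, rfl⟩ i j
    left
    simp only [step, diagonalStaircase, Prod.mk_sub_mk, Prod.mk.injEq]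
    constructor <;> ring
  · refine Set.Subset.antisymm (fun d hd => ?_) ?_
    · simp only [Set.biUnion_image, Set.mem_iUnion]
      exact ⟨d, hd, 0, by simp [diagonalStaircase]⟩
    · simp only [Set.biUnion_image, Set.iUnion_subset_iff]
      rintro d hd _ ⟨i, rfl⟩
      exact one d hd i

/-- A staircase advances by a diagonal unit step. -/
theorem IsDoublyInfiniteStaircase.step_mem {s : ℤ → Domino} (hs : IsDoublyInfiniteStaircase s)
    (i : ℤ) : ((step s i).1 = 1 ∨ (step s i).1 = -1) ∧
      ((step s i).2 = 1 ∨ (step s i).2 = -1) := by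
  obtain ⟨⟨a, b⟩, ⟨a', b'⟩, h1, h2, h3⟩ := hs.touch i
  have h4 := hs.parallel i (i + 1)
  have hd := ((hs.neighbours i (i + 1)).2 (.inr rfl)).1
  unfold step
  generalize s i = d at *
  generalize s (i + 1) = d' at *
  obtain ⟨⟨x, y⟩, o⟩ := d
  obtain ⟨⟨x', y'⟩, o'⟩ := d'
  dsimp only at h4
  subst h4
  have k := fun a b a' b' => h3 (a, b) (a', b')
  cases o
  · have k1 := k x y x y'
    have k2 := k (x + 1) y (x + 1) y'
    simp only [TouchAt, mem_squares, Adjacent, OnLongSide] at h1 h2 k1 k2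
    simp at h1 h2 k1 k2 ⊢
    omega
  · have k1 := k x y x' y
    have k2 := k x (y + 1) x' (y + 1)
    simp only [TouchAt, mem_squares, Adjacent, OnLongSide] at h1 h2 k1 k2
    simp at h1 h2 k1 k2 ⊢
    omega

/-- A staircase does not turn back: it would otherwise repeat a domino, which would then have the
neighbours of two different indices. -/
theorem IsDoublyInfiniteStaircase.step_ne_neg {s : ℤ → Domino}
    (hs : IsDoublyInfiniteStaircase s) (i : ℤ) : step s i ≠ -step s (i - 1) := by
  intro h
  have e : s (i + 1) = s (i - 1) := by
    have hb : (s (i + 1)).base = (s (i - 1)).base := by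
      simp only [step, sub_add_cancel] at h
      linear_combination (exp := 1) h
    exact Domino.ext hb (hs.parallel _ _)
  have h1 := (hs.neighbours (i + 1) (i + 2)).2 (.inr (by ring))
  rw [e, hs.neighbours] at h1
  omega

theorem ConsistsOfParallelStaircases.diagonalInvariant {t : Set Domino} (hne : t.Nonempty)
    (hc : ConsistsOfParallelStaircases t) :
    DiagonalInvariant (HorizontalAt t) (VerticalAt t) 1 ∨
      DiagonalInvariant (HorizontalAt t) (VerticalAt t) (-1) := by
  obtain ⟨C, hC, hpar, rfl⟩ := hc
  obtain ⟨d, hd⟩ := hne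
  simp only [Set.mem_iUnion] at hd
  obtain ⟨s₀, hs₀, -⟩ := hd
  obtain ⟨e, he, hstep⟩ : ∃ e : ℤ, (e = 1 ∨ e = -1) ∧ ∀ s ∈ C, ∀ i,
      step s i = (1, e) ∨ step s i = (-1, -e) := by
    obtain ⟨h1, h2⟩ := (hC s₀ hs₀).step_mem 0
    refine ⟨(step s₀ 0).1 * (step s₀ 0).2, ?_, fun s hs i => ?_⟩
    · rcases h1 with h1 | h1 <;> rcases h2 with h2 | h2 <;> simp [h1, h2]
    · have h3 := hpar s hs s₀ hs₀ i 0
      simp only [Prod.ext_iff, Prod.fst_neg, Prod.snd_neg] at h3 ⊢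
      rcases h1 with h1 | h1 <;> rcases h2 with h2 | h2 <;> simp only [h1, h2] at h3 ⊢ <;> omega
  have key : ∀ x y o, (⟨(x, y), o⟩ : Domino) ∈ ⋃ s ∈ C, Set.range s →
      (⟨(x + 1, y + e), o⟩ : Domino) ∈ ⋃ s ∈ C, Set.range s ∧
      (⟨(x - 1, y - e), o⟩ : Domino) ∈ ⋃ s ∈ C, Set.range s := by
    intro x y o hd
    simp only [Set.mem_iUnion] at hd ⊢
    obtain ⟨s, hs, i, hi⟩ := hd
    have h1 := hstep s hs i
    have h2 := hstep s hs (i - 1)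
    have h3 := (hC s hs).step_ne_neg i
    have h4 := (hC s hs).parallel (i + 1) i
    have h5 := (hC s hs).parallel (i - 1) i
    simp only [step, sub_add_cancel, hi] at h1 h2 h3 h4 h5
    have next : (s (i + 1) = ⟨(x + 1, y + e), o⟩ ∧ s (i - 1) = ⟨(x - 1, y - e), o⟩) ∨
        (s (i - 1) = ⟨(x + 1, y + e), o⟩ ∧ s (i + 1) = ⟨(x - 1, y - e), o⟩) := by
      simp only [Domino.ext_iff, h4, h5, and_true]
      simp only [Prod.ext_iff, Prod.fst_sub, Prod.snd_sub, Prod.fst_neg, Prod.snd_neg, ne_eq]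
        at h1 h2 h3 ⊢
      omega
    rcases next with ⟨n1, n2⟩ | ⟨n1, n2⟩
    · exact ⟨⟨s, hs, _, n1⟩, ⟨s, hs, _, n2⟩⟩
    · exact ⟨⟨s, hs, _, n1⟩, ⟨s, hs, _, n2⟩⟩
  have inv : DiagonalInvariant (HorizontalAt (⋃ s ∈ C, Set.range s))
      (VerticalAt (⋃ s ∈ C, Set.range s)) e :=
    fun x y => ⟨key x y false, key x y true⟩
  rcases he with rfl | rfl
  · exact .inl inv
  · exact .inr inv

/-! ### Mutual exclusion -/

theorem IsWindmill.not_admitsFlip {t : Set Domino} (hw : IsWindmill t) : ¬ AdmitsFlip t := by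
  obtain ⟨⟨x, y⟩, rfl | rfl⟩ := hw <;> rintro ⟨⟨a, b⟩, ⟨h1, h2⟩ | ⟨h1, h2⟩⟩ <;>
  · simp [northQuadrant, eastQuadrant, southQuadrant, westQuadrant, Int.even_iff] at h1 h2
    grind

theorem IsWindmill.core_or_mirrorCore {t : Set Domino} (hw : IsWindmill t) :
    (∃ x y, Core (HorizontalAt t) (VerticalAt t) x y) ∨
      ∃ x y, MirrorCore (HorizontalAt t) (VerticalAt t) x y := by
  obtain ⟨⟨x, y⟩, h⟩ := hw
  refine h.imp (fun h => ⟨x, y, ?_⟩) (fun h => ⟨x, y, ?_⟩)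
  · subst h
    refine ⟨.inl (.inl (.inl ?_)), .inl (.inl (.inr ?_)), .inl (.inr ?_), .inr ?_⟩ <;>
      simp [northQuadrant, eastQuadrant, southQuadrant, westQuadrant] <;> ring_nf <;> simp
  · subst h
    refine ⟨.inl (.inl (.inl ?_)), .inl (.inl (.inr ?_)), .inl (.inr ?_), .inr ?_⟩ <;>
      simp [northQuadrant, eastQuadrant, southQuadrant, westQuadrant] <;> ring_nf <;> simp

theorem IsWindmill.not_consistsOfParallelStaircases {t : Set Domino} (ht : IsTiling t)
    (hw : IsWindmill t) : ¬ ConsistsOfParallelStaircases t := by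
  intro hc
  have h := ht.flipFree hw.not_admitsFlip
  have hne : t.Nonempty := (ht (0, 0)).exists.imp fun d hd => hd.1
  rcases hw.core_or_mirrorCore with ⟨x, y, v, e, v', w⟩ | ⟨x, y, v, w, v', e⟩ <;>
    rcases hc.diagonalInvariant hne with hi | hi
  · exact h.hh _ _ w (by convert ((hi _ _).1 e).2 using 1; ring)
  · exact h.vv _ _ v' (by convert ((hi _ _).2 v).1 using 1 <;> ring)
  · exact h.vv _ _ v' (by convert ((hi _ _).2 v).2 using 1; ring)
  · exact h.hh _ _ w (by convert ((hi _ _).1 e).2 using 1 <;> ring)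

theorem ConsistsOfParallelStaircases.not_admitsFlip {t : Set Domino} (ht : IsTiling t)
    (hc : ConsistsOfParallelStaircases t) : ¬ AdmitsFlip t := by
  have hne : t.Nonempty := (ht (0, 0)).exists.imp fun d hd => hd.1
  rintro ⟨⟨x, y⟩, ⟨h1, h2⟩ | ⟨h1, h2⟩⟩ <;> rcases hc.diagonalInvariant hne with hi | hi
  · have := ht.eq_of_overlap (p := (x + 1, y + 1)) ((hi _ _).1 h1).1 h2
      (by simp [mem_squares]) (by simp [mem_squares])
    simp at this
  · have := ht.eq_of_overlap (p := (x + 1, y)) ((hi _ _).1 h2).1 h1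
      (by simp [mem_squares]) (by simp [mem_squares])
    simp at this
  · have := ht.eq_of_overlap (p := (x + 1, y + 1)) ((hi _ _).2 h1).1 h2
      (by simp [mem_squares]) (by simp [mem_squares])
    simp at this
  · have := ht.eq_of_overlap (p := (x, y + 1)) ((hi _ _).2 h2).2 h1
      (by simp [mem_squares]) (by simp [mem_squares])
    simp at this

theorem IsTiling.consistsOfParallelStaircases_or_isWindmill {t : Set Domino} (ht : IsTiling t)
    (hf : ¬ AdmitsFlip t) : ConsistsOfParallelStaircases t ∨ IsWindmill t := by
  rcases (ht.flipFree hf).invariantOrCore with o | o | ⟨x, y, o⟩ | ⟨x, y, o⟩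
  · exact .inl (consistsOfParallelStaircases_of_diagonalInvariant (.inl rfl) o)
  · exact .inl (consistsOfParallelStaircases_of_diagonalInvariant (.inr rfl) o)
  · exact .inr (ht.isWindmill_of_core hf o)
  · exact .inr (ht.isWindmill_of_mirrorCore hf o)

end DominoPlane

theorem theorem2 (t : Set DominoPlane.Domino) (ht : DominoPlane.IsTiling t) :
    (DominoPlane.AdmitsFlip t ∧ ¬ DominoPlane.ConsistsOfParallelStaircases t ∧
      ¬ DominoPlane.IsWindmill t) ∨
    (¬ DominoPlane.AdmitsFlip t ∧ DominoPlane.ConsistsOfParallelStaircases t ∧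
      ¬ DominoPlane.IsWindmill t) ∨
    (¬ DominoPlane.AdmitsFlip t ∧ ¬ DominoPlane.ConsistsOfParallelStaircases t ∧
      DominoPlane.IsWindmill t) := by
  have h1 := ht.consistsOfParallelStaircases_or_isWindmill
  have h2 := DominoPlane.ConsistsOfParallelStaircases.not_admitsFlip ht
  have h3 := DominoPlane.IsWindmill.not_admitsFlip (t := t)
  have h4 := DominoPlane.IsWindmill.not_consistsOfParallelStaircases ht
  tauto
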